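/- For $n\ge 0$ let $Q_n$ be the $n$-dimensional hypercube graph: its vertices are the binary strings of length $n$, and two are adjacent when they differ in exactly one coordinate. A finite graph $G$ is $2$-distinguishable if its vertices can be labeled with two labels so that only the trivial automorphism of $G$ preserves the labels (a $2$-distinguishing labeling); in that case $\rho(G)$, the cost of $2$-distinguishing $G$, is the minimum size of a label class over all $2$-distinguishing labelings of $G$. Let $X$ be an $m\times n$ binary matrix. A column permaut is a pair $(\pi,(\psi_j)_{j=1}^n)$, where $\pi$ is a permutation of $\{1,\dots,n\}$ and each $\psi_j$ is a bijection $\{0,1\}\to\{0,1\}$; it acts on $X$ by applying $\psi_j$ to every entry of column $j$, for each $j$, and then moving column $j$ to position $\pi(j)$. A symmetry of $X$ is a pair consisting of a row permutation $\sigma$ and a column permaut that have the same effect on $X$. The matrix $X$ is asymmetric if its only symmetry is the one in which $\sigma$, $\pi$ and all the $\psi_j$ are identities. For $m\ge 5$ let $\nu_m$ be the least number of columns of an asymmetric binary matrix with $m$ rows. Theorem. The graph $Q_n$ is $2$-distinguishable for every $n\ge 4$, and an asymmetric binary matrix with $m$ rows exists for every $m\ge 5$, so that $\rho(Q_n)$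 for $n\ge 4$ and $\nu_m$ for $m\ge 5$ are well defined. For every integer $n$ with $4\le n\le 12$, $\rho(Q_n)=5$. For every integer $n\ge 13$ there is a unique integer $m\ge 6$ with $$2^{m-2}-\nu_{m-1}+1\le n\le 2^{m-1}-\nu_m,$$ and $\rho(Q_n)=m$ for this $m$. -/

import Mathlib

namespace HypercubeCost

/-- The `n`-dimensional hypercube: binary strings of length `n`, adjacent when they differ in
exactly one coordinate. -/
def hypercube (n : ℕ) : SimpleGraph (Fin n → Bool) where
  Adj u v := hammingDist u v = 1
  symm := ⟨fun u v h => by rwa [hammingDist_comm]⟩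
  loopless := ⟨fun u h => by simp at h⟩

/-- A labeling of the vertices with `d` labels is distinguishing if only the trivial automorphism
of the graph preserves the labels. -/
def IsDistinguishing {V : Type*} (G : SimpleGraph V) {d : ℕ} (c : V → Fin d) : Prop :=
  ∀ f : G ≃g G, (∀ v, c (f v) = c v) → ∀ v, f v = v

/-- `G` is `d`-distinguishable if it has a distinguishing labeling with `d` labels. -/
def IsDistinguishable {V : Type*} (G : SimpleGraph V) (d : ℕ) : Prop :=
  ∃ c : V → Fin d, IsDistinguishing G c

/-- The cost of 2-distinguishing a finite graph: the minimum size of a label class, over all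
distinguishing labelings with two labels. -/
noncomputable def cost {V : Type*} [Finite V] (G : SimpleGraph V) : ℕ :=
  sInf {k | ∃ c : V → Fin 2, IsDistinguishing G c ∧ ∃ i : Fin 2, {v | c v = i}.ncard = k}

/-- Apply a row permutation to a binary matrix: row `i` is moved to position `σ i`. -/
def permuteRows {m n : ℕ} (σ : Equiv.Perm (Fin m)) (X : Matrix (Fin m) (Fin n) Bool) :
    Matrix (Fin m) (Fin n) Bool :=
  Matrix.of fun i j => X (σ⁻¹ i) j

/-- Apply a column permaut to a binary matrix: each entry of column `j` is transformed by the
bijection `ψ j` of the two symbols, and column `j` is then moved to position `π j`. -/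
def permautCols {m n : ℕ} (π : Equiv.Perm (Fin n)) (ψ : Fin n → Equiv.Perm Bool)
    (X : Matrix (Fin m) (Fin n) Bool) : Matrix (Fin m) (Fin n) Bool :=
  Matrix.of fun i j => ψ (π⁻¹ j) (X i (π⁻¹ j))

/-- A binary matrix is asymmetric if its only symmetry, that is, the only pair of a row permutation
and a column permaut with the same effect on it, is the trivial one. -/
def IsAsymmetric {m n : ℕ} (X : Matrix (Fin m) (Fin n) Bool) : Prop :=
  ∀ (σ : Equiv.Perm (Fin m)) (π : Equiv.Perm (Fin n)) (ψ : Fin n → Equiv.Perm Bool),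
    permuteRows σ X = permautCols π ψ X → σ = 1 ∧ π = 1 ∧ ψ = 1

/-- The least number of columns of an asymmetric binary matrix with `m` rows. -/
noncomputable def nu (m : ℕ) : ℕ :=
  sInf {n | ∃ X : Matrix (Fin m) (Fin n) Bool, IsAsymmetric X}

end HypercubeCost

namespace HypercubeCost

/-! Automorphisms of the hypercube are exactly the column permauts, so a label class of size `m` in
a 2-distinguishing labeling is the row set of an asymmetric `m × n` matrix
(`hasAsymmetric_iff_vertices`). Hence the cost is the least `m` for which such a matrix exists, and
the task is to find, for each `m`, the admissible `n`.

For this, read the matrix by columns. Up to complement, the columns are `n` distinct complementary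
pairs of subsets of the rows, and asymmetry says that no nontrivial permutation of the rows
preserves this family (`IsAsymFamily`). Passing to the remaining pairs shows that `n` is admissible
iff `2 ^ (m - 1) - n` is. For `m ≥ 5` the admissible `n` form the interval from `nu m` to `2 ^ (m -
1) - nu m` (`hasAsymmetric_iff`): below `m - 1` one pair at a time can be added
(`IsAsymFamily.exists_succ`), from `m - 1` to `2 ^ (m - 2)` a path makes the family rigid
(`hasAsymmetric_of_path`), and complementation gives the upper half.

The upper ends of these intervals strictly increase with `m`, while each new interval starts below
the previous upper end, so the cost is the first `m` whose upper end reaches `n`. For `n ≥ 4` fewer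
than five rows never suffice, and `nu 5 = 4` because complementing five of the eight vertices of the
3-cube leaves three rows, which are never asymmetric. -/

/-- `HasAsymmetric m n` says that an asymmetric binary `m × n` matrix exists. -/
def HasAsymmetric (m n : ℕ) : Prop :=
  ∃ X : Matrix (Fin m) (Fin n) Bool, IsAsymmetric X

/-! ### Automorphisms of the hypercube are column permauts -/

section Automorphisms

variable {n : ℕ}

/-- The action of a column permaut on a single row. -/
def permautRow (π : Equiv.Perm (Fin n)) (ψ : Fin n → Equiv.Perm Bool) :
    (Fin n → Bool) ≃ (Fin n → Bool) where
  toFun v j := ψ (π⁻¹ j) (v (π⁻¹ j))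
  invFun w j := (ψ j)⁻¹ (w (π j))
  left_inv v := by ext j; simp
  right_inv w := by ext j; simp

theorem permautRow_apply (π : Equiv.Perm (Fin n)) (ψ : Fin n → Equiv.Perm Bool)
    (v : Fin n → Bool) (j : Fin n) : permautRow π ψ v j = ψ (π⁻¹ j) (v (π⁻¹ j)) := rfl

theorem hammingDist_permautRow (π : Equiv.Perm (Fin n)) (ψ : Fin n → Equiv.Perm Bool)
    (u v : Fin n → Bool) :
    hammingDist (permautRow π ψ u) (permautRow π ψ v) = hammingDist u v := by
  unfold hammingDist
  symm
  refine Finset.card_bij (fun i _ => π i) ?_ ?_ ?_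
  · intro i hi
    simpa [permautRow_apply] using hi
  · intro i _ j _ h
    exact π.injective h
  · intro j hj
    refine ⟨π⁻¹ j, ?_, by simp⟩
    simpa [permautRow_apply] using hj

/-- A column permaut, as an automorphism of the hypercube. -/
def permautIso (π : Equiv.Perm (Fin n)) (ψ : Fin n → Equiv.Perm Bool) :
    hypercube n ≃g hypercube n where
  toEquiv := permautRow π ψ
  map_rel_iff' := by
    intro u v
    simp [hypercube, hammingDist_permautRow]

theorem permautRow_eq_id {π : Equiv.Perm (Fin n)} {ψ : Fin n → Equiv.Perm Bool}
    (h : ∀ v, permautRow π ψ v = v) : π = 1 ∧ ψ = 1 := by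
  have hψ : ψ = 1 := by
    funext i
    have h0 := congrFun (h fun _ => false) (π i)
    have h1 := congrFun (h fun _ => true) (π i)
    simp only [permautRow_apply, Equiv.Perm.inv_def, Equiv.symm_apply_apply] at h0 h1
    ext b
    cases b
    · simp [h0]
    · simp [h1]
  refine ⟨?_, hψ⟩
  subst hψ
  ext i
  have h0 := congrFun (h fun k => decide (k = i)) (π i)
  simp only [permautRow_apply, Equiv.Perm.inv_def, Equiv.symm_apply_apply, Pi.one_apply, Equiv.Perm.one_apply] at h0
  have h1 : π i = i := by simpa using h0.symm
  simp [h1]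

theorem hammingDist_update_not (u : Fin n → Bool) (i : Fin n) :
    hammingDist u (Function.update u i (!u i)) = 1 := by
  unfold hammingDist
  rw [Finset.card_eq_one]
  refine ⟨i, ?_⟩
  ext j
  by_cases hj : j = i
  · subst hj; simp
  · simp [hj]

theorem hammingDist_update_add_one {u v : Fin n → Bool} {i : Fin n} (h : u i ≠ v i) :
    hammingDist (Function.update u i (v i)) v + 1 = hammingDist u v := by
  unfold hammingDist
  have : (Finset.univ.filter fun j => Function.update u i (v i) j ≠ v j) =
      (Finset.univ.filter fun j => u j ≠ v j).erase i := by
    ext j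
    by_cases hj : j = i
    · subst hj; simp
    · simp [hj]
  rw [this, Finset.card_erase_add_one]
  simpa using h

/-- Induct along a geodesic: flipping one differing coordinate of `u` costs one step in the image.
Applied to an automorphism and its inverse, this shows that automorphisms are isometries. -/
theorem hammingDist_map_le {f : (Fin n → Bool) → (Fin n → Bool)}
    (hf : ∀ u v, hammingDist u v = 1 → hammingDist (f u) (f v) = 1) (d : ℕ) :
    ∀ u v, hammingDist u v = d → hammingDist (f u) (f v) ≤ d := by
  induction d with
  | zero =>
    intro u v h
    rw [hammingDist_eq_zero] at h
    simp [h]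
  | succ d ih =>
    intro u v h
    obtain ⟨i, hi⟩ : ∃ i, u i ≠ v i := by
      by_contra! hc
      rw [funext hc, hammingDist_self] at h
      omega
    have h1 := hammingDist_update_add_one hi
    have h2 := hammingDist_update_not u i
    have hv : v i = !u i := by
      cases hu : u i <;> cases hv : v i <;> simp_all
    have h3 := ih (Function.update u i (v i)) v (by omega)
    rw [← hv] at h2
    have h4 := hf _ _ h2
    have h5 := hammingDist_triangle (f u) (f (Function.update u i (v i))) (f v)
    omega

theorem hammingDist_iso (f : hypercube n ≃g hypercube n) (u v : Fin n → Bool) :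
    hammingDist (f u) (f v) = hammingDist u v := by
  apply le_antisymm
  · exact hammingDist_map_le (f := f) (fun u v h => f.map_adj_iff.2 h) _ u v rfl
  · have := hammingDist_map_le (f := f.symm) (fun u v h => f.symm.map_adj_iff.2 h) _
      (f u) (f v) rfl
    simpa using this

/-- Flipping a coordinate brings `u` closer to `v` exactly when they differ there. -/
theorem hammingDist_update_lt_iff (u v : Fin n → Bool) (i : Fin n) :
    hammingDist (Function.update u i (!u i)) v < hammingDist u v ↔ u i ≠ v i := by
  by_cases h : u i = v i
  · have h1 := hammingDist_update_add_one (u := Function.update u i (!u i)) (v := v) (i := i)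
      (by simp [h])
    rw [Function.update_idem, ← h, Function.update_eq_self] at h1
    simp only [h, ne_eq, not_true_eq_false, iff_false, not_lt]
    rw [← h]
    omega
  · have h1 := hammingDist_update_add_one h
    have hv : v i = !u i := by
      cases hu : u i <;> cases hv : v i <;> simp_all
    rw [← hv]
    simp only [ne_eq, h, not_false_eq_true, iff_true]
    omega

theorem exists_update_of_hammingDist_eq_one {u v : Fin n → Bool} (h : hammingDist u v = 1) :
    ∃ i, v = Function.update u i (!u i) := by
  unfold hammingDist at h
  obtain ⟨i, hi⟩ := Finset.card_eq_one.1 h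
  refine ⟨i, ?_⟩
  funext j
  have hj := Finset.ext_iff.1 hi j
  simp only [Finset.mem_filter, Finset.mem_univ, true_and, Finset.mem_singleton] at hj
  by_cases hji : j = i
  · subst hji
    have := hj.2 rfl
    cases hu : u j <;> cases hv : v j <;> simp_all
  · rw [Function.update_of_ne hji]
    exact (not_not.1 (mt hj.1 hji)).symm

/-- Every automorphism of the hypercube is a column permaut. -/
theorem exists_permautRow_eq (f : hypercube n ≃g hypercube n) :
    ∃ (π : Equiv.Perm (Fin n)) (ψ : Fin n → Equiv.Perm Bool), ∀ v, f v = permautRow π ψ v := by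
  set o : Fin n → Bool := fun _ => false with ho
  have key : ∀ i, ∃ k, f (Function.update o i (!o i)) = Function.update (f o) k (!f o k) := by
    intro i
    apply exists_update_of_hammingDist_eq_one
    rw [hammingDist_iso]
    exact hammingDist_update_not o i
  choose p hp using key
  -- Flipping coordinate `i` of `o` approaches `v` exactly when they differ there; `f` turns this
  -- into the same test at coordinate `p i`. So bit `i` of `v` determines bit `p i` of `f v`.
  have hcoord : ∀ v i, f o (p i) ≠ f v (p i) ↔ o i ≠ v i := by
    intro v i
    rw [← hammingDist_update_lt_iff, ← hammingDist_update_lt_iff, ← hp, hammingDist_iso,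
      hammingDist_iso]
  have hinj : Function.Injective p := by
    intro i j hij
    by_contra hne
    have h1 := hcoord (Function.update o i (!o i)) i
    have h2 := hcoord (Function.update o i (!o i)) j
    rw [← hij, h1] at h2
    simp [Function.update_of_ne (Ne.symm hne)] at h2
  let π : Equiv.Perm (Fin n) := Equiv.ofBijective p (Finite.injective_iff_bijective.1 hinj)
  refine ⟨π, fun i => if f o (p i) then Equiv.boolNot else 1, ?_⟩
  intro v
  funext j
  obtain ⟨i, rfl⟩ := π.surjective j
  have hπ : π i = p i := rfl
  rw [permautRow_apply, Equiv.Perm.inv_def, Equiv.symm_apply_apply, hπ]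
  have := hcoord v i
  simp only [ho] at this
  cases h1 : f o (p i) <;> cases h2 : f v (p i) <;> cases h3 : v i <;>
    simp_all

end Automorphisms

/-! ### Distinguishing label classes as row sets of asymmetric matrices -/

section Vertices

variable {m n : ℕ}

theorem permuteRows_eq_permautCols_iff {σ : Equiv.Perm (Fin m)} {π : Equiv.Perm (Fin n)}
    {ψ : Fin n → Equiv.Perm Bool} {X : Matrix (Fin m) (Fin n) Bool} :
    permuteRows σ X = permautCols π ψ X ↔ ∀ i, X (σ⁻¹ i) = permautRow π ψ (X i) := by
  constructor
  · intro h i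
    exact congrFun h i
  · intro h
    exact funext h

theorem IsAsymmetric.row_injective {X : Matrix (Fin m) (Fin n) Bool} (hX : IsAsymmetric X) :
    Function.Injective X := by
  intro i j hij
  by_contra hne
  have h := (hX (Equiv.swap i j) 1 1 (by
    rw [permuteRows_eq_permautCols_iff]
    intro k
    funext l
    simp only [permautRow_apply, Equiv.swap_inv, inv_one, Equiv.Perm.one_apply, Pi.one_apply]
    by_cases hi : k = i
    · subst hi; simp [hij]
    · by_cases hj : k = j
      · subst hj; simp [hij]
      · rw [Equiv.swap_apply_of_ne_of_ne hi hj])).1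
  exact hne (Equiv.swap_eq_one_iff.1 h)

/-- Asymmetric `m × n` matrices correspond to `m`-sets of vertices of the hypercube that no
nontrivial automorphism preserves. -/
theorem hasAsymmetric_iff_vertices :
    HasAsymmetric m n ↔ ∃ S : Finset (Fin n → Bool), S.card = m ∧
      ∀ f : hypercube n ≃g hypercube n, (∀ v, f v ∈ S ↔ v ∈ S) → ∀ v, f v = v := by
  constructor
  · rintro ⟨X, hX⟩
    refine ⟨Finset.univ.image fun i => X i, ?_, ?_⟩
    · rw [Finset.card_image_of_injective _ hX.row_injective, Finset.card_univ, Fintype.card_fin]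
    · intro f hf
      have h1 : ∀ i, ∃ k, X k = f (X i) := by
        intro i
        have := (hf (X i)).2 (Finset.mem_image_of_mem _ (Finset.mem_univ _))
        simpa using this
      choose t ht using h1
      have htinj : Function.Injective t := by
        intro i j hij
        apply hX.row_injective
        apply f.injective
        rw [← ht, ← ht, hij]
      let τ : Equiv.Perm (Fin m) := Equiv.ofBijective t (Finite.injective_iff_bijective.1 htinj)
      obtain ⟨π, ψ, hπ⟩ := exists_permautRow_eq f
      -- `permuteRows σ` puts row `σ⁻¹ i` at position `i`, so the row permutation induced by `f`
      -- enters as an inverse.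
      obtain ⟨-, rfl, rfl⟩ := hX τ⁻¹ π ψ (by
        rw [permuteRows_eq_permautCols_iff]
        intro i
        rw [inv_inv, ← hπ]
        exact ht i)
      intro v
      rw [hπ]
      funext j
      simp [permautRow_apply]
  · rintro ⟨S, hS, hf⟩
    let e : Fin m ≃ S := (Finset.equivFinOfCardEq hS).symm
    refine ⟨Matrix.of fun i => (e i : Fin n → Bool), ?_⟩
    intro σ π ψ h
    replace h : ∀ i, (e (σ⁻¹ i) : Fin n → Bool) = permautRow π ψ (e i) :=
      permuteRows_eq_permautCols_iff.1 h
    have h1 : ∀ v, permautRow π ψ v ∈ S ↔ v ∈ S := by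
      intro v
      constructor
      · intro hv
        have h2 := h (σ (e.symm ⟨_, hv⟩))
        simp only [Equiv.Perm.inv_def, Equiv.symm_apply_apply, Equiv.apply_symm_apply,
          EmbeddingLike.apply_eq_iff_eq] at h2
        rw [h2]
        exact Subtype.coe_prop _
      · intro hv
        have h2 := h (e.symm ⟨v, hv⟩)
        simp only [Equiv.apply_symm_apply] at h2
        rw [← h2]
        exact Subtype.coe_prop _
    obtain ⟨rfl, rfl⟩ := permautRow_eq_id (hf (permautIso π ψ) h1)
    refine ⟨?_, rfl, rfl⟩
    rw [← inv_eq_one]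
    ext i
    have h2 := h i
    have h3 : permautRow 1 1 (e i : Fin n → Bool) = e i := by
      funext j
      simp [permautRow_apply]
    rw [h3, SetLike.coe_eq_coe, e.injective.eq_iff] at h2
    rw [h2]
    rfl

/-- An automorphism preserves a vertex set iff it preserves its complement. -/
theorem HasAsymmetric.compl_rows (h : HasAsymmetric m n) : HasAsymmetric (2 ^ n - m) n := by
  rw [hasAsymmetric_iff_vertices] at h ⊢
  obtain ⟨S, hS, hf⟩ := h
  refine ⟨Sᶜ, ?_, ?_⟩
  · rw [Finset.card_compl, hS]
    simp
  · intro f h1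
    refine hf f fun v => ?_
    have := h1 v
    rw [Finset.mem_compl, Finset.mem_compl] at this
    tauto

theorem exists_distinguishing_iff {k : ℕ} :
    (∃ c : (Fin n → Bool) → Fin 2, IsDistinguishing (hypercube n) c ∧
      ∃ i : Fin 2, {v | c v = i}.ncard = k) ↔ HasAsymmetric k n := by
  rw [hasAsymmetric_iff_vertices]
  constructor
  · rintro ⟨c, hc, i, hi⟩
    refine ⟨Finset.univ.filter fun v => c v = i, ?_, ?_⟩
    · rw [← hi, ← Set.ncard_coe_finset]
      simp
    · intro f hf
      refine hc f fun v => ?_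
      have := hf v
      simp only [Finset.mem_filter, Finset.mem_univ, true_and] at this
      omega
  · rintro ⟨S, hS, hf⟩
    refine ⟨fun v => if v ∈ S then 1 else 0, ?_, 1, ?_⟩
    · intro f h
      refine hf f fun v => ?_
      have := h v
      by_cases h1 : f v ∈ S <;> by_cases h2 : v ∈ S <;> simp_all
    · rw [← hS, ← Set.ncard_coe_finset]
      congr 1
      ext v
      simp

theorem cost_hypercube (n : ℕ) : cost (hypercube n) = sInf {k | HasAsymmetric k n} := by
  unfold cost
  congr 1
  ext k
  exact exists_distinguishing_iff

theorem HasAsymmetric.isDistinguishable {k : ℕ} (h : HasAsymmetric k n) :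
    IsDistinguishable (hypercube n) 2 := by
  obtain ⟨c, hc, -⟩ := exists_distinguishing_iff.2 h
  exact ⟨c, hc⟩

end Vertices

/-! ### Columns as complement-closed families of sets -/

section Columns

variable {m n : ℕ}

/-- A family of sets closed under complements, with `n` complementary pairs, that no nontrivial
permutation of the points preserves. The columns of an asymmetric matrix, together with their
complements, form such a family. -/
structure IsAsymFamily (F : Finset (Finset (Fin m))) (n : ℕ) : Prop where
  compl_mem : ∀ A ∈ F, Aᶜ ∈ F
  card_eq : F.card = 2 * n
  eq_one : ∀ σ : Equiv.Perm (Fin m), (∀ A, A.map σ.toEmbedding ∈ F ↔ A ∈ F) → σ = 1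

theorem IsAsymFamily.compl_mem_iff {F : Finset (Finset (Fin m))} (hF : IsAsymFamily F n)
    {A : Finset (Fin m)} : Aᶜ ∈ F ↔ A ∈ F :=
  ⟨fun h => compl_compl A ▸ hF.compl_mem _ h, hF.compl_mem A⟩

theorem map_mem_iff_of_forall_map_mem {F : Finset (Finset (Fin m))} {σ : Equiv.Perm (Fin m)}
    (h : ∀ A ∈ F, A.map σ.toEmbedding ∈ F) (A : Finset (Fin m)) :
    A.map σ.toEmbedding ∈ F ↔ A ∈ F := by
  refine ⟨fun hA => ?_, h A⟩
  have h1 : F.map (Finset.mapEmbedding σ.toEmbedding).toEmbedding = F := by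
    apply Finset.eq_of_subset_of_card_le
    · intro B hB
      obtain ⟨C, hC, rfl⟩ := Finset.mem_map.1 hB
      exact h C hC
    · rw [Finset.card_map]
  rw [← h1] at hA
  obtain ⟨B, hB, hBA⟩ := Finset.mem_map.1 hA
  rwa [← Finset.map_injective _ hBA]

theorem map_inv_mem_iff {F : Finset (Finset (Fin m))} {σ : Equiv.Perm (Fin m)}
    (h : ∀ A, A.map σ.toEmbedding ∈ F ↔ A ∈ F) (A : Finset (Fin m)) :
    A.map σ⁻¹.toEmbedding ∈ F ↔ A ∈ F := by
  rw [← h]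
  have : (A.map σ⁻¹.toEmbedding).map σ.toEmbedding = A := by
    rw [Finset.map_map]
    convert Finset.map_refl using 2
    ext x
    simp
  rw [this]

theorem mem_map_inv {σ : Equiv.Perm (Fin m)} {A : Finset (Fin m)} {x : Fin m} :
    x ∈ A.map σ⁻¹.toEmbedding ↔ σ x ∈ A := by
  rw [Finset.mem_map_equiv]
  rfl

theorem map_compl_perm (σ : Equiv.Perm (Fin m)) (A : Finset (Fin m)) :
    Aᶜ.map σ.toEmbedding = (A.map σ.toEmbedding)ᶜ := by
  ext x
  simp [Finset.mem_map_equiv]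

/-- The closure of a family of sets under complements. -/
def complClosure (G : Finset (Finset (Fin m))) : Finset (Finset (Fin m)) :=
  G ∪ G.image compl

theorem mem_complClosure {G : Finset (Finset (Fin m))} {A : Finset (Fin m)} :
    A ∈ complClosure G ↔ A ∈ G ∨ Aᶜ ∈ G := by
  simp only [complClosure, Finset.mem_union, Finset.mem_image]
  refine or_congr_right ⟨?_, fun h => ⟨_, h, compl_compl A⟩⟩
  rintro ⟨B, hB, rfl⟩
  rwa [compl_compl]

theorem compl_mem_complClosure {G : Finset (Finset (Fin m))} {A : Finset (Fin m)}
    (h : A ∈ complClosure G) : Aᶜ ∈ complClosure G := by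
  rw [mem_complClosure] at h ⊢
  rw [compl_compl]
  exact h.symm

theorem card_complClosure {G : Finset (Finset (Fin m))} (h : ∀ A ∈ G, Aᶜ ∉ G) :
    (complClosure G).card = 2 * G.card := by
  rw [complClosure, Finset.card_union_of_disjoint, Finset.card_image_of_injective _
    compl_injective, two_mul]
  rw [Finset.disjoint_left]
  intro A hA hA'
  obtain ⟨B, hB, rfl⟩ := Finset.mem_image.1 hA'
  exact h B hB hA

/-- The set of rows in which column `j` has the entry `true`. -/
def colSet (X : Matrix (Fin m) (Fin n) Bool) (j : Fin n) : Finset (Fin m) :=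
  Finset.univ.filter fun i => X i j = true

theorem mem_colSet {X : Matrix (Fin m) (Fin n) Bool} {i : Fin m} {j : Fin n} :
    i ∈ colSet X j ↔ X i j = true := by
  simp [colSet]

/-- Two columns that are equal or complementary could be exchanged by a permaut with no effect on
the matrix. -/
theorem IsAsymmetric.eq_of_colSet_eq {X : Matrix (Fin m) (Fin n) Bool} (hX : IsAsymmetric X)
    {j k : Fin n} {p : Equiv.Perm Bool} (h : ∀ i, X i k = p (X i j)) : j = k := by
  by_contra hne
  have h1 := (hX 1 (Equiv.swap j k)
    (fun l => if l = j then p else if l = k then p⁻¹ else 1) (by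
      rw [permuteRows_eq_permautCols_iff]
      intro i
      funext l
      simp only [permautRow_apply, Equiv.swap_inv, inv_one, Equiv.Perm.one_apply]
      by_cases hj : l = j
      · subst hj
        simp [Ne.symm hne, h i]
      · by_cases hk : l = k
        · subst hk
          simp [h i]
        · simp [Equiv.swap_apply_of_ne_of_ne hj hk, hj, hk])).2.1
  exact hne (Equiv.swap_eq_one_iff.1 h1)

theorem colSet_eq_iff {X Y : Matrix (Fin m) (Fin n) Bool} {j k : Fin n} :
    colSet X j = colSet Y k ↔ ∀ i, X i j = Y i k := by
  simp only [Finset.ext_iff, mem_colSet]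
  exact forall_congr' fun i => Bool.eq_iff_iff.symm

theorem colSet_eq_compl_iff {X Y : Matrix (Fin m) (Fin n) Bool} {j k : Fin n} :
    colSet X j = (colSet Y k)ᶜ ↔ ∀ i, X i j = !Y i k := by
  simp only [Finset.ext_iff, Finset.mem_compl, mem_colSet]
  refine forall_congr' fun i => ?_
  cases X i j <;> cases Y i k <;> simp

theorem IsAsymmetric.isAsymFamily (hm : 0 < m) {X : Matrix (Fin m) (Fin n) Bool}
    (hX : IsAsymmetric X) : IsAsymFamily (complClosure (Finset.univ.image (colSet X))) n where
  compl_mem _ := compl_mem_complClosure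
  card_eq := by
    rw [card_complClosure, Finset.card_image_of_injective, Finset.card_univ, Fintype.card_fin]
    · intro j k h
      rw [colSet_eq_iff] at h
      exact hX.eq_of_colSet_eq (p := 1) fun i => (h i).symm
    · intro A hA hA'
      obtain ⟨j, -, rfl⟩ := Finset.mem_image.1 hA
      obtain ⟨k, -, hk⟩ := Finset.mem_image.1 hA'
      rw [colSet_eq_compl_iff] at hk
      obtain rfl := hX.eq_of_colSet_eq (p := Equiv.boolNot) hk
      simpa using hk ⟨0, hm⟩
  eq_one := by
    intro σ hσ
    have h1 : ∀ j, ∃ (k : Fin n) (p : Equiv.Perm Bool), ∀ i, X (σ⁻¹ i) k = p (X i j) := by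
      intro j
      have h2 : (colSet X j).map σ⁻¹.toEmbedding ∈
          complClosure (Finset.univ.image (colSet X)) := by
        rw [map_inv_mem_iff hσ, mem_complClosure]
        exact Or.inl (Finset.mem_image_of_mem _ (Finset.mem_univ _))
      have h3 : ∀ i, σ⁻¹ i ∈ (colSet X j).map σ⁻¹.toEmbedding ↔ X i j = true := by
        intro i
        rw [mem_map_inv, Equiv.Perm.inv_def, Equiv.apply_symm_apply, mem_colSet]
      rcases mem_complClosure.1 h2 with h2 | h2 <;>
        obtain ⟨k, -, hk⟩ := Finset.mem_image.1 h2
      · refine ⟨k, 1, fun i => ?_⟩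
        rw [Equiv.Perm.one_apply, Bool.eq_iff_iff, ← h3, ← hk, mem_colSet]
      · refine ⟨k, Equiv.boolNot, fun i => ?_⟩
        have h4 := h3 i
        rw [← compl_compl (Finset.map _ _), ← hk, Finset.mem_compl, mem_colSet] at h4
        cases h5 : X (σ⁻¹ i) k <;> cases h6 : X i j <;> simp_all
    choose p ψ hp using h1
    have hinj : Function.Injective p := by
      intro j k hjk
      refine hX.eq_of_colSet_eq (p := (ψ k)⁻¹ * ψ j) fun i => ?_
      rw [Equiv.Perm.mul_apply, ← hp, hjk, hp, Equiv.Perm.inv_def, Equiv.symm_apply_apply]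
    let π : Equiv.Perm (Fin n) := Equiv.ofBijective p (Finite.injective_iff_bijective.1 hinj)
    refine (hX σ π ψ ?_).1
    rw [permuteRows_eq_permautCols_iff]
    intro i
    funext j
    obtain ⟨j, rfl⟩ := π.surjective j
    rw [permautRow_apply, Equiv.Perm.inv_def π, Equiv.symm_apply_apply]
    exact hp j i

theorem HasAsymmetric.exists_isAsymFamily (hm : 0 < m) (h : HasAsymmetric m n) :
    ∃ F : Finset (Finset (Fin m)), IsAsymFamily F n := by
  obtain ⟨X, hX⟩ := h
  exact ⟨_, hX.isAsymFamily hm⟩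

/-- Exactly one set of each complementary pair avoids `x`; these are canonical representatives. -/
theorem IsAsymFamily.card_filter_notMem {F : Finset (Finset (Fin m))} (hF : IsAsymFamily F n)
    (x : Fin m) : (F.filter fun A => x ∉ A).card = n := by
  have h1 : (F.filter fun A => x ∈ A).card = (F.filter fun A => x ∉ A).card := by
    refine Finset.card_bij (fun A _ => Aᶜ) ?_ ?_ ?_
    · intro A hA
      rw [Finset.mem_filter] at hA ⊢
      exact ⟨hF.compl_mem _ hA.1, by simpa using hA.2⟩
    · intro A _ B _ h
      exact compl_injective h
    · intro A hA
      rw [Finset.mem_filter] at hA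
      refine ⟨Aᶜ, ?_, compl_compl A⟩
      rw [Finset.mem_filter]
      exact ⟨hF.compl_mem _ hA.1, by simpa using hA.2⟩
  have h2 := Finset.card_filter_add_card_filter_not (s := F) (fun A => x ∈ A)
  have h3 := hF.card_eq
  omega

/-- The columns are the members avoiding row `x`. Any matrix symmetry permutes the pairs, so its row
permutation is trivial; then row `x`, which is constantly `false`, rules out complementing a column.
-/
theorem IsAsymFamily.hasAsymmetric (hm : 0 < m) {F : Finset (Finset (Fin m))}
    (hF : IsAsymFamily F n) : HasAsymmetric m n := by
  set x : Fin m := ⟨0, hm⟩ with hx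
  let e : Fin n ≃ (F.filter fun A => x ∉ A) :=
    (Finset.equivFinOfCardEq (hF.card_filter_notMem x)).symm
  have he : ∀ j, (e j : Finset (Fin m)) ∈ F ∧ x ∉ (e j : Finset (Fin m)) := fun j =>
    Finset.mem_filter.1 (e j).2
  refine ⟨Matrix.of fun i j => decide (i ∈ (e j : Finset (Fin m))), ?_⟩
  intro σ π ψ h
  replace h : ∀ i j, decide (σ⁻¹ i ∈ (e (π j) : Finset (Fin m))) =
      ψ j (decide (i ∈ (e j : Finset (Fin m)))) := by
    intro i j
    have := congrFun (permuteRows_eq_permautCols_iff.1 h i) (π j)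
    rw [permautRow_apply, Equiv.Perm.inv_def π, Equiv.symm_apply_apply] at this
    exact this
  have hσ : σ = 1 := by
    rw [← inv_eq_one]
    refine hF.eq_one _ (map_mem_iff_of_forall_map_mem ?_)
    have hcol : ∀ j, (e j : Finset (Fin m)).map σ⁻¹.toEmbedding ∈ F := by
      intro j
      have h1 : ∀ i, decide (i ∈ (e (π j) : Finset (Fin m))) =
          ψ j (decide (σ i ∈ (e j : Finset (Fin m)))) := by
        intro i
        rw [← h, Equiv.Perm.inv_def, Equiv.symm_apply_apply]
      by_cases hψ : ψ j false = false
      · have h2 : ψ j true ≠ ψ j false := (ψ j).injective.ne (by decide)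
        have h3 : (e j : Finset (Fin m)).map σ⁻¹.toEmbedding = e (π j) := by
          ext i
          rw [mem_map_inv]
          replace h1 := h1 i
          clear h
          by_cases h4 : σ i ∈ (e j : Finset (Fin m)) <;> simp_all
        rw [h3]
        exact (he _).1
      · have h2 : ψ j true ≠ ψ j false := (ψ j).injective.ne (by decide)
        have h3 : (e j : Finset (Fin m)).map σ⁻¹.toEmbedding = (e (π j) : Finset (Fin m))ᶜ := by
          ext i
          rw [mem_map_inv, Finset.mem_compl]
          replace h1 := h1 i
          clear h
          by_cases h4 : σ i ∈ (e j : Finset (Fin m)) <;> simp_all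
        rw [h3]
        exact hF.compl_mem _ (he _).1
    intro A hA
    by_cases hxA : x ∈ A
    · have h1 := hcol (e.symm ⟨Aᶜ, Finset.mem_filter.2 ⟨hF.compl_mem _ hA, by simpa using hxA⟩⟩)
      rw [Equiv.apply_symm_apply, map_compl_perm] at h1
      exact hF.compl_mem_iff.1 h1
    · have h1 := hcol (e.symm ⟨A, Finset.mem_filter.2 ⟨hA, hxA⟩⟩)
      rwa [Equiv.apply_symm_apply] at h1
  subst hσ
  have hψ : ψ = 1 := by
    funext j
    have h0 := h x j
    simp only [inv_one, Equiv.Perm.one_apply, (he _).2, decide_false] at h0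
    ext b
    have h1 : ψ j true ≠ ψ j false := (ψ j).injective.ne (by decide)
    cases b
    · exact h0.symm
    · rw [← h0] at h1
      simpa using h1
  subst hψ
  refine ⟨rfl, ?_, rfl⟩
  ext j
  have : e (π j) = e j := by
    ext i
    have := h i j
    simpa using this
  rw [e.injective this]
  rfl

/-- The `2 ^ m` subsets form `2 ^ (m - 1)` pairs, and a family has the same symmetries as the family
of all other sets. -/
theorem IsAsymFamily.compl {F : Finset (Finset (Fin m))} (hm : 0 < m) (hF : IsAsymFamily F n) :
    IsAsymFamily Fᶜ (2 ^ (m - 1) - n) where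
  compl_mem A hA := by
    rw [Finset.mem_compl] at hA ⊢
    rwa [hF.compl_mem_iff]
  card_eq := by
    obtain ⟨m, rfl⟩ : ∃ k, m = k + 1 := ⟨m - 1, by omega⟩
    rw [Finset.card_compl, hF.card_eq, Fintype.card_finset, Fintype.card_fin, pow_succ,
      Nat.add_sub_cancel]
    omega
  eq_one σ hσ := hF.eq_one σ fun A => by
    have := hσ A
    rw [Finset.mem_compl, Finset.mem_compl] at this
    tauto

theorem HasAsymmetric.compl_columns (hm : 0 < m) (h : HasAsymmetric m n) :
    HasAsymmetric m (2 ^ (m - 1) - n) := by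
  obtain ⟨F, hF⟩ := h.exists_isAsymFamily hm
  exact (hF.compl hm).hasAsymmetric hm

theorem HasAsymmetric.le_two_pow (hm : 0 < m) (h : HasAsymmetric m n) : n ≤ 2 ^ (m - 1) := by
  obtain ⟨F, hF⟩ := h.exists_isAsymFamily hm
  obtain ⟨m, rfl⟩ : ∃ k, m = k + 1 := ⟨m - 1, by omega⟩
  have h1 := Finset.card_le_univ F
  rw [hF.card_eq, Fintype.card_finset, Fintype.card_fin, pow_succ] at h1
  rw [Nat.add_sub_cancel]
  omega

end Columns

/-! ### Adding one complementary pair -/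

section Extension

variable {m n : ℕ}

/-- A symmetry of the enlarged family that does not send `B` into `F` must preserve the new pair,
hence also `F`. -/
theorem IsAsymFamily.insert_pair {F : Finset (Finset (Fin m))} (hF : IsAsymFamily F n)
    {B : Finset (Fin m)} (hm : 0 < m) (hB : B ∉ F)
    (h : ∀ σ : Equiv.Perm (Fin m),
      (∀ A, A.map σ.toEmbedding ∈ insert B (insert Bᶜ F) ↔ A ∈ insert B (insert Bᶜ F)) →
        B.map σ.toEmbedding ∉ F) :
    IsAsymFamily (insert B (insert Bᶜ F)) (n + 1) where
  compl_mem A hA := by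
    simp only [Finset.mem_insert] at hA ⊢
    rcases hA with rfl | rfl | hA
    · simp
    · simp
    · exact Or.inr (Or.inr (hF.compl_mem A hA))
  card_eq := by
    have : Nonempty (Fin m) := ⟨⟨0, hm⟩⟩
    have h1 : Bᶜ ∉ F := by rwa [hF.compl_mem_iff]
    have h2 : B ∉ insert Bᶜ F := by
      rw [Finset.mem_insert, not_or]
      exact ⟨ne_compl_self, hB⟩
    rw [Finset.card_insert_of_notMem h2, Finset.card_insert_of_notMem h1, hF.card_eq]
    ring
  eq_one σ hσ := by
    have h1 : B.map σ.toEmbedding = B ∨ B.map σ.toEmbedding = Bᶜ := by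
      have h2 := (hσ B).2 (Finset.mem_insert_self _ _)
      have h3 := h σ hσ
      simp only [Finset.mem_insert, ← or_assoc] at h2
      exact h2.resolve_right h3
    have h2 : ∀ A, (A.map σ.toEmbedding = B ∨ A.map σ.toEmbedding = Bᶜ) ↔ (A = B ∨ A = Bᶜ) := by
      intro A
      rw [← (Finset.map_injective σ.toEmbedding).eq_iff (a := A) (b := B),
        ← (Finset.map_injective σ.toEmbedding).eq_iff (a := A) (b := Bᶜ), map_compl_perm]
      rcases h1 with h1 | h1 <;> rw [h1]
      rw [compl_compl, or_comm]
    have h3 : Bᶜ ∉ F := by rwa [hF.compl_mem_iff]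
    refine hF.eq_one σ fun A => ?_
    have h4 := hσ A
    have h5 := h2 A
    simp only [Finset.mem_insert, ← or_assoc] at h4
    by_cases h6 : A = B ∨ A = Bᶜ
    · have h7 := h5.2 h6
      have h8 : A ∉ F := by rcases h6 with h6 | h6 <;> rwa [h6]
      have h9 : A.map σ.toEmbedding ∉ F := by rcases h7 with h7 | h7 <;> rwa [h7]
      exact iff_of_false h9 h8
    · rwa [or_iff_right (mt h5.1 h6), or_iff_right h6] at h4

/-- A family with fewer than `m - 1` complementary pairs can be extended by one more pair. -/
theorem IsAsymFamily.exists_succ {F : Finset (Finset (Fin m))} (hF : IsAsymFamily F n)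
    (hn : n + 2 ≤ m) : ∃ F' : Finset (Finset (Fin m)), IsAsymFamily F' (n + 1) := by
  have hm : 0 < m := by omega
  set x₀ : Fin m := ⟨0, hm⟩
  set L : Finset (Fin m) := Finset.univ.filter fun x => {x} ∈ F with hL
  have memL : ∀ x, x ∈ L ↔ {x} ∈ F := by simp [hL]
  by_cases hLe : L = ∅
  · have h1 : ∀ x, {x} ∉ F := fun x hx => by
      rw [← memL, hLe] at hx
      simp at hx
    refine ⟨_, hF.insert_pair hm (h1 x₀) fun σ _ => ?_⟩
    rw [Finset.map_singleton]
    exact h1 _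
  have hl0 : 1 ≤ L.card := Finset.card_pos.2 (Finset.nonempty_iff_ne_empty.2 hLe)
  -- If all singletons were in `F`, the `m - 1` of them avoiding `x₀` would force `n ≥ m - 1`.
  have hl1 : L.card < m := by
    by_contra! hc
    have hLu : L = Finset.univ := by
      rw [← Finset.card_eq_iff_eq_univ, Fintype.card_fin]
      exact le_antisymm (by simpa using Finset.card_le_univ L) hc
    have h1 : ((Finset.univ.erase x₀).image fun y : Fin m => ({y} : Finset (Fin m))) ⊆
        F.filter fun A => x₀ ∉ A := by
      intro A hA
      obtain ⟨y, hy, rfl⟩ := Finset.mem_image.1 hA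
      rw [Finset.mem_filter]
      refine ⟨(memL y).1 (hLu ▸ Finset.mem_univ y), ?_⟩
      rw [Finset.mem_singleton]
      exact (Finset.ne_of_mem_erase hy).symm
    have h2 := Finset.card_le_card h1
    rw [hF.card_filter_notMem, Finset.card_image_of_injective _ Finset.singleton_injective,
      Finset.card_erase_of_mem (Finset.mem_univ _), Finset.card_univ, Fintype.card_fin] at h2
    omega
  set l := L.card with hl
  have hlc : Lᶜ.card = m - l := by rw [Finset.card_compl, Fintype.card_fin]
  -- The type `τ A` is invariant under permutations preserving `L`. There are at least `2 * m`
  -- types; discarding those of a singleton outside `L` and of its complement still leaves more than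
  -- the `2 * n` sets of `F` can use. Take `B` of an unused type.
  set τ : Finset (Fin m) → ℕ × ℕ := fun A => ((A ∩ L).card, (A ∩ Lᶜ).card) with hτ
  have hcard : (F.image τ).card <
      (((Finset.range (l + 1) ×ˢ Finset.range (m - l + 1)).erase (0, 1)).erase
        (l, m - l - 1)).card := by
    have h1 : (F.image τ).card ≤ 2 * n := hF.card_eq ▸ Finset.card_image_le
    have h2 := Finset.pred_card_le_card_erase
      (s := (Finset.range (l + 1) ×ˢ Finset.range (m - l + 1)).erase (0, 1)) (a := (l, m - l - 1))
    have h3 := Finset.pred_card_le_card_erase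
      (s := Finset.range (l + 1) ×ˢ Finset.range (m - l + 1)) (a := (0, 1))
    rw [Finset.card_product, Finset.card_range, Finset.card_range] at h3
    obtain ⟨d, hd⟩ : ∃ d, m = l + d + 1 := ⟨m - l - 1, by omega⟩
    have h4 : 2 * m ≤ (l + 1) * (m - l + 1) := by
      rw [hd, show l + d + 1 - l = d + 1 by omega]
      nlinarith [Nat.mul_le_mul_right d hl0]
    omega
  obtain ⟨⟨a, b⟩, hab, habF⟩ := Finset.exists_mem_notMem_of_card_lt_card hcard
  simp only [Finset.mem_erase, Finset.mem_product, Finset.mem_range, ne_eq, Prod.mk.injEq] at hab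
  obtain ⟨B₁, hB₁, hB₁c⟩ := Finset.exists_subset_card_eq (s := L) (n := a) (by omega)
  obtain ⟨B₂, hB₂, hB₂c⟩ := Finset.exists_subset_card_eq (s := Lᶜ) (n := b) (by omega)
  set B := B₁ ∪ B₂ with hB
  have hd : ∀ x, x ∈ B₁ → x ∈ L := fun x hx => hB₁ hx
  have hd' : ∀ x, x ∈ B₂ → x ∉ L := fun x hx => Finset.mem_compl.1 (hB₂ hx)
  have hBL : B ∩ L = B₁ := by
    ext x
    have h1 := hd x
    have h2 := hd' x
    clear * - h1 h2 hB
    simp only [hB, Finset.mem_inter, Finset.mem_union]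
    tauto
  have hBLc : B ∩ Lᶜ = B₂ := by
    ext x
    have h1 := hd x
    have h2 := hd' x
    clear * - h1 h2 hB
    simp only [hB, Finset.mem_inter, Finset.mem_union, Finset.mem_compl]
    tauto
  have hτB : τ B = (a, b) := by simp only [hτ, hBL, hBLc, hB₁c, hB₂c]
  have hτF : ∀ A ∈ F, τ A ≠ τ B := by
    intro A hA h
    rw [hτB] at h
    exact habF (h ▸ Finset.mem_image_of_mem τ hA)
  have hBF : B ∉ F := fun h => hτF B h rfl
  have hsingle : ∀ x, {x} ∉ F → {x} ≠ B ∧ {x} ≠ Bᶜ := by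
    intro x hx
    rw [← memL] at hx
    refine ⟨fun h => ?_, fun h => ?_⟩
    · have h1 : τ B = (0, 1) := by
        rw [← h]
        simp [hτ, hx]
      rw [hτB, Prod.mk.injEq] at h1
      tauto
    · have h0 : B = {x}ᶜ := by rw [h, compl_compl]
      have h1 : τ B = (l, m - l - 1) := by
        rw [h0]
        simp only [hτ, Prod.mk.injEq]
        constructor
        · rw [hl]
          congr 1
          ext y
          simp only [Finset.mem_inter, Finset.mem_compl, Finset.mem_singleton, and_iff_right_iff_imp]
          rintro hy rfl
          exact hx hy
        · rw [← hlc, ← Finset.card_erase_of_mem (Finset.mem_compl.2 hx)]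
          congr 1
          ext y
          simp [Finset.mem_erase]
      rw [hτB, Prod.mk.injEq] at h1
      tauto
  refine ⟨_, hF.insert_pair hm hBF fun σ hσ => ?_⟩
  have hBFc : Bᶜ ∉ F := by rwa [hF.compl_mem_iff]
  -- Neither `B` nor `Bᶜ` is a new singleton, so `L` can be recovered from the enlarged family and
  -- each symmetry preserves it, hence preserves types.
  have hs : ∀ x, ({x} : Finset (Fin m)) ∈ insert B (insert Bᶜ F) ↔ x ∈ L := by
    intro x
    rw [memL, Finset.mem_insert, Finset.mem_insert]
    have := hsingle x
    constructor
    · rintro (h | h | h)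
      · by_contra hc
        exact (this hc).1 h
      · by_contra hc
        exact (this hc).2 h
      · exact h
    · tauto
  have hσL : ∀ x, σ x ∈ L ↔ x ∈ L := by
    intro x
    rw [← hs, ← hs, ← hσ {x}, Finset.map_singleton]
    rfl
  have hτσ : τ (B.map σ.toEmbedding) = τ B := by
    have h1 : L.map σ.toEmbedding = L := by
      ext x
      rw [Finset.mem_map_equiv, ← hσL, Equiv.apply_symm_apply]
    have h2 : Lᶜ.map σ.toEmbedding = Lᶜ := by rw [map_compl_perm, h1]
    simp only [hτ, Prod.mk.injEq]
    constructor
    · rw [← Finset.card_map σ.toEmbedding (s := B ∩ L), Finset.map_inter, h1]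
    · rw [← Finset.card_map σ.toEmbedding (s := B ∩ Lᶜ), Finset.map_inter, h2]
  exact fun h => hτF _ h hτσ

theorem HasAsymmetric.succ (h : HasAsymmetric m n) (hn : n + 2 ≤ m) :
    HasAsymmetric m (n + 1) := by
  obtain ⟨F, hF⟩ := h.exists_isAsymFamily (by omega)
  obtain ⟨F', hF'⟩ := hF.exists_succ hn
  exact hF'.hasAsymmetric (by omega)

theorem HasAsymmetric.of_le {k : ℕ} (h : HasAsymmetric m n) (hnk : n ≤ k) (hk : k + 1 ≤ m) :
    HasAsymmetric m k := by
  induction k, hnk using Nat.le_induction with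
  | base => exact h
  | succ k _ ih => exact (ih (by omega)).succ (by omega)

end Extension

/-! ### Rigid families built from a path -/

section Path

variable {k n : ℕ}

/-- A permutation that preserves a family whose two-element sets are the edges of a path missing
only the last point, and which contains the singleton of exactly one end of the path, is trivial. -/
theorem eq_one_of_path (hk : 2 ≤ k) {F : Finset (Finset (Fin (k + 1)))}
    (h0 : {⟨0, by omega⟩} ∈ F) (h1 : {⟨k - 1, by omega⟩} ∉ F)
    (hadj : ∀ x y : Fin (k + 1), x ≠ y →
      ({x, y} ∈ F ↔ (x.val + 1 = y.val ∧ y.val < k) ∨ (y.val + 1 = x.val ∧ x.val < k)))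
    {σ : Equiv.Perm (Fin (k + 1))} (hσ : ∀ A, A.map σ.toEmbedding ∈ F ↔ A ∈ F) : σ = 1 := by
  have hσadj : ∀ x y : Fin (k + 1), x ≠ y →
      ((((σ x).val + 1 = (σ y).val ∧ (σ y).val < k) ∨
        ((σ y).val + 1 = (σ x).val ∧ (σ x).val < k)) ↔
      ((x.val + 1 = y.val ∧ y.val < k) ∨ (y.val + 1 = x.val ∧ x.val < k))) := by
    intro x y hxy
    rw [← hadj x y hxy, ← hadj _ _ (σ.injective.ne hxy), ← hσ {x, y}, Finset.map_insert,
      Finset.map_singleton]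
    rfl
  -- Point `0` has a single neighbour, so its image is an end of the path; the singleton condition
  -- excludes the far end.
  have hzero : (σ ⟨0, by omega⟩).val = 0 := by
    by_contra hne
    set p := (σ ⟨0, by omega⟩).val with hp
    have h01 := (hσadj ⟨0, by omega⟩ ⟨1, by omega⟩ (by simp)).2 (by left; simp; omega)
    have hpk : p ≠ k - 1 := by
      intro h
      have h2 := (hσ {⟨0, by omega⟩}).2 h0
      rw [Finset.map_singleton] at h2
      apply h1
      convert h2 using 2
      exact Fin.ext h.symm
    obtain ⟨u, hu⟩ := σ.surjective ⟨p - 1, by omega⟩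
    obtain ⟨v, hv⟩ := σ.surjective ⟨p + 1, by omega⟩
    have hu0 : ⟨0, by omega⟩ ≠ u := by
      intro h
      rw [← h] at hu
      have := congrArg Fin.val hu
      simp only at this
      omega
    have hv0 : ⟨0, by omega⟩ ≠ v := by
      intro h
      rw [← h] at hv
      have := congrArg Fin.val hv
      simp only at this
      omega
    have h2 := (hσadj _ u hu0).1 (by rw [hu]; simp only; omega)
    have h3 := (hσadj _ v hv0).1 (by rw [hv]; simp only; omega)
    have h4 : u = v := Fin.ext (by simp only at h2 h3; omega)
    rw [h4, hv] at hu
    have := congrArg Fin.val hu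
    simp only at this
    omega
  have hpath : ∀ i (hi : i < k), (σ ⟨i, by omega⟩).val = i := by
    intro i
    induction i using Nat.strong_induction_on with
    | _ i ih =>
      intro hi
      rcases Nat.eq_zero_or_pos i with rfl | hpos
      · exact hzero
      obtain ⟨j, rfl⟩ : ∃ j, i = j + 1 := ⟨i - 1, by omega⟩
      have h2 := ih j (by omega) (by omega)
      have h3 := (hσadj ⟨j, by omega⟩ ⟨j + 1, by omega⟩ (by simp)).2 (by left; simp; omega)
      rw [h2] at h3
      by_contra hne
      -- The image of `j + 1` is a neighbour of `j`, and the neighbour `j - 1` is already taken.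
      have h4 := ih (j - 1) (by omega) (by omega)
      have h5 : (σ ⟨j - 1, by omega⟩) = σ ⟨j + 1, by omega⟩ := Fin.ext (by omega)
      have h6 := congrArg Fin.val (σ.injective h5)
      simp only at h6
      omega
  ext x
  rw [Equiv.Perm.one_apply]
  by_cases hx : x.val < k
  · exact hpath x hx
  · by_contra hne
    have h2 : (σ x).val < k := by omega
    have h3 := hpath _ h2
    have h4 := congrArg Fin.val (σ.injective (Fin.ext h3))
    exact hne h4

/-- The edges of the path through all points of `Fin (k + 1)` but the last. -/
def pathEdges (k : ℕ) : Finset (Finset (Fin (k + 1))) :=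
  Finset.univ.image fun i : Fin (k - 1) => {⟨i, by omega⟩, ⟨i + 1, by omega⟩}

theorem mem_pathEdges {x y : Fin (k + 1)} (hxy : x ≠ y) :
    {x, y} ∈ pathEdges k ↔
      (x.val + 1 = y.val ∧ y.val < k) ∨ (y.val + 1 = x.val ∧ x.val < k) := by
  simp only [pathEdges, Finset.mem_image, Finset.mem_univ, true_and]
  constructor
  · rintro ⟨i, hi⟩
    have h1 : x ∈ ({x, y} : Finset (Fin (k + 1))) := by simp
    have h2 : y ∈ ({x, y} : Finset (Fin (k + 1))) := by simp
    rw [← hi] at h1 h2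
    simp only [Finset.mem_insert, Finset.mem_singleton, Fin.ext_iff] at h1 h2
    have := Fin.val_ne_of_ne hxy
    omega
  · rintro (⟨h1, h2⟩ | ⟨h1, h2⟩)
    · refine ⟨⟨x, by omega⟩, ?_⟩
      rw [show (⟨x.val + 1, by omega⟩ : Fin (k + 1)) = y from Fin.ext h1]
    · refine ⟨⟨y, by omega⟩, ?_⟩
      rw [show (⟨y.val + 1, by omega⟩ : Fin (k + 1)) = x from Fin.ext h1, Finset.pair_comm]

theorem card_pathEdges (k : ℕ) : (pathEdges k).card = k - 1 := by
  rw [pathEdges, Finset.card_image_of_injective, Finset.card_univ, Fintype.card_fin]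
  intro i j hij
  simp only [Finset.ext_iff, Finset.mem_insert, Finset.mem_singleton, Fin.ext_iff] at hij
  have h1 : i.val = j.val ∨ i.val = j.val + 1 := (hij ⟨i, by omega⟩).1 (Or.inl rfl)
  have h2 : j.val = i.val ∨ j.val = i.val + 1 := (hij ⟨j, by omega⟩).2 (Or.inl rfl)
  exact Fin.ext (by omega)

theorem card_of_mem_pathEdges {A : Finset (Fin (k + 1))} (hA : A ∈ pathEdges k) : A.card = 2 := by
  simp only [pathEdges, Finset.mem_image, Finset.mem_univ, true_and] at hA
  obtain ⟨i, rfl⟩ := hA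
  rw [Finset.card_pair]
  simp [Fin.ext_iff]

theorem last_notMem_of_mem_pathEdges {A : Finset (Fin (k + 1))} (hA : A ∈ pathEdges k) :
    Fin.last k ∉ A := by
  simp only [pathEdges, Finset.mem_image, Finset.mem_univ, true_and] at hA
  obtain ⟨i, rfl⟩ := hA
  simp only [Finset.mem_insert, Finset.mem_singleton, Fin.ext_iff, Fin.val_last]
  omega

theorem choose_two_add_two_le (hk : 4 ≤ k) : k.choose 2 + 2 ≤ 2 ^ (k - 1) := by
  induction k, hk using Nat.le_induction with
  | base => decide
  | succ k hk ih =>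
    have h1 : (k + 1).choose 2 = k + k.choose 2 := by
      rw [Nat.choose_succ_succ' k 1, Nat.choose_one_right]
    have h2 : 2 ^ (k + 1 - 1) = 2 * 2 ^ (k - 1) := by
      rw [← pow_succ']
      congr 1
      omega
    have h3 : k ≤ k.choose 2 + 2 := by
      rw [Nat.choose_two_right]
      have : 2 * k ≤ k * (k - 1) := by
        rw [mul_comm]
        exact Nat.mul_le_mul_left k (by omega)
      omega
    omega

theorem hasAsymmetric_of_path (hk : 4 ≤ k) (hkn : k ≤ n) (hn : n ≤ 2 ^ (k - 1)) :
    HasAsymmetric (k + 1) n := by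
  set V : Finset (Fin (k + 1)) := Finset.univ.erase (Fin.last k) with hV
  have hVc : V.card = k := by simp [hV]
  set e : Finset (Fin (k + 1)) := {⟨k - 1, by omega⟩} with he
  set R : Finset (Finset (Fin (k + 1))) := insert {⟨0, by omega⟩} (pathEdges k) with hR
  -- A two-element set enters the closure of `G` either directly or through its complement of size
  -- `k - 1`. Hence `U` allows, among sets of these two sizes, only the path edges, and it also
  -- excludes the far singleton `e`. Any `G` between `R` and `U` is rigid, so its size is free.
  set D : Finset (Finset (Fin (k + 1))) := V.powersetCard 2 ∪ V.powersetCard (k - 1) with hD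
  set U : Finset (Finset (Fin (k + 1))) := V.powerset \ (insert e (D \ pathEdges k)) with hU
  have hsub : ∀ A : Finset (Fin (k + 1)), A ⊆ V ↔ Fin.last k ∉ A := by
    intro A
    rw [hV, Finset.subset_erase]
    simp
  have hED : pathEdges k ⊆ D := by
    intro A hA
    rw [hD, Finset.mem_union, Finset.mem_powersetCard]
    exact Or.inl ⟨(hsub A).2 (last_notMem_of_mem_pathEdges hA), card_of_mem_pathEdges hA⟩
  have hDc : D.card ≤ k.choose 2 + k := by
    refine (Finset.card_union_le _ _).trans ?_
    rw [Finset.card_powersetCard, Finset.card_powersetCard, hVc,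
      Nat.choose_symm_of_eq_add (show k = (k - 1) + 1 by omega), Nat.choose_one_right]
  have hUc : 2 ^ (k - 1) ≤ U.card := by
    have h1 := Finset.le_card_sdiff (insert e (D \ pathEdges k)) V.powerset
    have h2 := Finset.card_insert_le e (D \ pathEdges k)
    rw [Finset.card_sdiff_of_subset hED, card_pathEdges] at h2
    rw [Finset.card_powerset, hVc] at h1
    have h3 := choose_two_add_two_le hk
    have h4 : 2 ^ k = 2 * 2 ^ (k - 1) := by
      rw [← pow_succ']
      congr 1
      omega
    rw [← hU] at h1
    omega
  have hRc : R.card ≤ k := by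
    have h1 := Finset.card_insert_le {⟨0, by omega⟩} (pathEdges k)
    rw [card_pathEdges, ← hR] at h1
    omega
  have hRU : R ⊆ U := by
    intro A hA
    rw [hU, Finset.mem_sdiff, Finset.mem_powerset, hsub, Finset.mem_insert, Finset.mem_sdiff]
    rcases Finset.mem_insert.1 hA with rfl | hA
    · refine ⟨?_, ?_⟩
      · rw [Finset.mem_singleton, Fin.ext_iff]
        simp only [Fin.val_last]
        omega
      · rintro (h | ⟨h, -⟩)
        · rw [he, Finset.singleton_inj, Fin.ext_iff] at h
          simp only at h
          omega
        · rw [hD, Finset.mem_union, Finset.mem_powersetCard, Finset.mem_powersetCard,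
            Finset.card_singleton] at h
          omega
    · refine ⟨last_notMem_of_mem_pathEdges hA, ?_⟩
      rintro (rfl | ⟨-, h⟩)
      · have := card_of_mem_pathEdges hA
        rw [he, Finset.card_singleton] at this
        omega
      · exact h hA
  obtain ⟨G, hRG, hGU, hGc⟩ := Finset.exists_subsuperset_card_eq hRU (hRc.trans hkn)
    (hn.trans hUc)
  have hGlast : ∀ A ∈ G, Fin.last k ∉ A := fun A hA =>
    (hsub A).1 (Finset.mem_powerset.1 (Finset.mem_sdiff.1 (hGU hA)).1)
  have hGD : ∀ A ∈ G, A.card = 2 ∨ A.card = k - 1 → A ∈ pathEdges k := by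
    intro A hA hAc
    by_contra hc
    refine (Finset.mem_sdiff.1 (hGU hA)).2 (Finset.mem_insert_of_mem (Finset.mem_sdiff.2 ⟨?_, hc⟩))
    rw [hD, Finset.mem_union, Finset.mem_powersetCard, Finset.mem_powersetCard, hsub]
    have := hGlast A hA
    tauto
  refine IsAsymFamily.hasAsymmetric (F := complClosure G) (by omega)
    ⟨fun A => compl_mem_complClosure, ?_, fun σ => eq_one_of_path (by omega) ?_ ?_ ?_⟩
  · rw [card_complClosure, hGc]
    intro A hA hA'
    exact hGlast _ hA' (Finset.mem_compl.2 (hGlast _ hA))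
  · exact mem_complClosure.2 (Or.inl (hRG (Finset.mem_insert_self _ _)))
  · rw [mem_complClosure, not_or]
    constructor
    · intro h
      exact (Finset.mem_sdiff.1 (hGU h)).2 (Finset.mem_insert_self _ _)
    · intro h
      refine hGlast _ h ?_
      rw [Finset.mem_compl, Finset.mem_singleton, Fin.ext_iff]
      simp only [Fin.val_last]
      omega
  · intro x y hxy
    rw [← mem_pathEdges hxy, mem_complClosure]
    constructor
    · rintro (h | h)
      · exact hGD _ h (Or.inl (Finset.card_pair hxy))
      · have h1 : ({x, y} : Finset (Fin (k + 1)))ᶜ.card = k - 1 := by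
          rw [Finset.card_compl, Fintype.card_fin, Finset.card_pair hxy]
          omega
        have h2 := card_of_mem_pathEdges (hGD _ h (Or.inr h1))
        omega
    · intro h
      exact Or.inl (hRG (Finset.mem_insert_of_mem h))

end Path

/-! ### Fewer than five rows, and the least column number for five -/

section SmallRows

variable {n : ℕ}

theorem HasAsymmetric.eq_zero (h : HasAsymmetric 0 n) : n = 0 := by
  obtain ⟨X, hX⟩ := h
  by_contra hn
  have h1 := (hX 1 1 (fun _ => Equiv.boolNot) (funext fun i => i.elim0)).2.2
  have h2 := congrFun (congrArg DFunLike.coe (congrFun h1 ⟨0, by omega⟩)) true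
  simp at h2

/-- Asymmetry of a family is witnessed on one set out of each complementary pair. -/
theorem IsAsymFamily.not_forall_map_mem_iff {m : ℕ} {F : Finset (Finset (Fin m))}
    (hF : IsAsymFamily F n) {H : Finset (Finset (Fin m))} (hH : ∀ A, A ∈ H ∨ Aᶜ ∈ H)
    {σ : Equiv.Perm (Fin m)} (hσ : σ ≠ 1) : ¬ ∀ A ∈ H, (A.map σ.toEmbedding ∈ F ↔ A ∈ F) := by
  intro h
  refine hσ (hF.eq_one σ fun A => ?_)
  rcases hH A with hA | hA
  · exact h A hA
  · have := h _ hA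
    rwa [map_compl_perm, hF.compl_mem_iff, hF.compl_mem_iff] at this

/-- Two of the three singletons agree on membership in `F`, so their transposition preserves it. -/
theorem not_hasAsymmetric_three : ¬ HasAsymmetric 3 n := by
  intro h
  obtain ⟨F, hF⟩ := h.exists_isAsymFamily (by norm_num)
  have key := fun σ => hF.not_forall_map_mem_iff (H := {∅, {0}, {1}, {2}}) (by decide) (σ := σ)
  have h1 := key (Equiv.swap 0 1) (by decide)
  have h2 := key (Equiv.swap 0 2) (by decide)
  have h3 := key (Equiv.swap 1 2) (by decide)
  simp [Equiv.swap_apply_def] at h1 h2 h3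
  tauto

theorem not_hasAsymmetric_four : ¬ HasAsymmetric 4 n := by
  intro h
  obtain ⟨F, hF⟩ := h.exists_isAsymFamily (by norm_num)
  have key := fun σ => hF.not_forall_map_mem_iff
    (H := {∅, {0}, {1}, {2}, {3}, {0, 1}, {0, 2}, {0, 3}}) (by decide) (σ := σ)
  have c12 : {1, 2} ∈ F ↔ {0, 3} ∈ F := by
    rw [← hF.compl_mem_iff, show ({1, 2} : Finset (Fin 4))ᶜ = {0, 3} by decide]
  have c13 : {1, 3} ∈ F ↔ {0, 2} ∈ F := by
    rw [← hF.compl_mem_iff, show ({1, 3} : Finset (Fin 4))ᶜ = {0, 2} by decide]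
  have c23 : {2, 3} ∈ F ↔ {0, 1} ∈ F := by
    rw [← hF.compl_mem_iff, show ({2, 3} : Finset (Fin 4))ᶜ = {0, 1} by decide]
  have c (i j : Fin 4) : ({i, j} : Finset (Fin 4)) = {j, i} := Finset.pair_comm i j
  have h1 := key (Equiv.swap 0 1) (by decide)
  have h2 := key (Equiv.swap 0 2) (by decide)
  have h3 := key (Equiv.swap 0 3) (by decide)
  have h4 := key (Equiv.swap 1 2) (by decide)
  have h5 := key (Equiv.swap 1 3) (by decide)
  have h6 := key (Equiv.swap 2 3) (by decide)
  have h7 := key (Equiv.swap 0 1 * Equiv.swap 2 3) (by decide)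
  have h8 := key (Equiv.swap 0 2 * Equiv.swap 1 3) (by decide)
  have h9 := key (Equiv.swap 0 3 * Equiv.swap 1 2) (by decide)
  simp [Equiv.swap_apply_def, c 1 0, c 2 0, c 3 0, c 2 1, c 3 1, c 3 2, c12, c13, c23]
    at h1 h2 h3 h4 h5 h6 h7 h8 h9
  clear key c c12 c13 c23
  -- Two of the three splits into pairs agree. In the first case, swapping `0, 3` or `1, 2` only
  -- exchanges those splits, so the singletons `0, 3` differ in membership and so do `1, 2`. Then
  -- one of the double transpositions in `h7`, `h8`, which fix all splits, matches equal singletons.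
  -- The other cases are alike.
  rcases (show ({0, 1} ∈ F ↔ {0, 2} ∈ F) ∨ ({0, 1} ∈ F ↔ {0, 3} ∈ F) ∨
    ({0, 2} ∈ F ↔ {0, 3} ∈ F) by grind) with h | h | h
  · replace h3 := fun u => h3 u u.symm h.symm h
    replace h4 := fun u => h4 u u.symm h.symm h
    clear h1 h2 h5 h6 h9 h
    grind
  · replace h2 := fun u => h2 u u.symm h.symm h
    replace h5 := fun u => h5 u u.symm h.symm h
    clear h1 h3 h4 h6 h8 h
    grind
  · replace h1 := fun u => h1 u u.symm h.symm h
    replace h6 := fun u => h6 u u.symm h.symm h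
    clear h2 h3 h4 h5 h7 h
    grind

theorem five_le_of_hasAsymmetric {m : ℕ} (h : HasAsymmetric m n) (hn : 4 ≤ n) : 5 ≤ m := by
  by_contra! hm
  interval_cases m
  · have := h.eq_zero
    omega
  · have := h.le_two_pow (by norm_num)
    omega
  · have := h.le_two_pow (by norm_num)
    omega
  · exact not_hasAsymmetric_three h
  · exact not_hasAsymmetric_four h

/-- Fewer columns could be extended to three; complementing the five rows in the 3-cube would leave
an asymmetric matrix with `2 ^ 3 - 5 = 3` rows. -/
theorem four_le_of_hasAsymmetric_five (h : HasAsymmetric 5 n) : 4 ≤ n := by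
  by_contra! hn
  exact not_hasAsymmetric_three (h.of_le (k := 3) (by omega) (by norm_num)).compl_rows

end SmallRows

/-! ### Intervals of admissible column numbers and the cost -/

section Main

variable {m n : ℕ}

theorem hasAsymmetric_of_le_of_le (hm : 5 ≤ m) (h1 : m - 1 ≤ n) (h2 : n ≤ 2 ^ (m - 2)) :
    HasAsymmetric m n := by
  obtain ⟨k, rfl⟩ : ∃ k, m = k + 1 := ⟨m - 1, by omega⟩
  exact hasAsymmetric_of_path (by omega) h1 h2

theorem two_mul_le_two_pow (hm : 5 ≤ m) : 2 * m ≤ 2 ^ (m - 2) + 2 := by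
  induction m, hm using Nat.le_induction with
  | base => norm_num
  | succ m hm ih =>
    rw [show m + 1 - 2 = (m - 2) + 1 by omega, pow_succ]
    omega

theorem hasAsymmetric_pred (hm : 5 ≤ m) : HasAsymmetric m (m - 1) :=
  hasAsymmetric_of_le_of_le hm le_rfl (by have := two_mul_le_two_pow hm; omega)

theorem hasAsymmetric_nu (hm : 5 ≤ m) : HasAsymmetric m (nu m) :=
  Nat.sInf_mem (s := {n | HasAsymmetric m n}) ⟨_, hasAsymmetric_pred hm⟩

theorem nu_le (h : HasAsymmetric m n) : nu m ≤ n :=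
  Nat.sInf_le (s := {n | HasAsymmetric m n}) h

theorem nu_le_pred (hm : 5 ≤ m) : nu m ≤ m - 1 :=
  nu_le (hasAsymmetric_pred hm)

theorem nu_five : nu 5 = 4 :=
  le_antisymm (nu_le_pred le_rfl) (four_le_of_hasAsymmetric_five (hasAsymmetric_nu le_rfl))

theorem two_pow_pred (hm : 2 ≤ m) : 2 ^ (m - 1) = 2 * 2 ^ (m - 2) := by
  rw [← pow_succ']
  congr 1
  omega

/-- The numbers of columns of asymmetric matrices with `m` rows form an interval. -/
theorem hasAsymmetric_iff (hm : 5 ≤ m) :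
    HasAsymmetric m n ↔ nu m ≤ n ∧ n + nu m ≤ 2 ^ (m - 1) := by
  have hpow := two_pow_pred (m := m) (by omega)
  constructor
  · intro h
    have h1 := nu_le (h.compl_columns (by omega))
    have h2 := h.le_two_pow (by omega)
    exact ⟨nu_le h, by omega⟩
  · rintro ⟨h1, h2⟩
    have lower : ∀ k, nu m ≤ k → k ≤ 2 ^ (m - 2) → HasAsymmetric m k := by
      intro k hk hk'
      rcases le_or_gt k (m - 1) with h | h
      · exact (hasAsymmetric_nu hm).of_le hk (by omega)
      · exact hasAsymmetric_of_le_of_le hm h.le hk'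
    rcases le_or_gt n (2 ^ (m - 2)) with h | h
    · exact lower n h1 h
    · have h3 := (lower (2 ^ (m - 1) - n) (by omega) (by omega)).compl_columns (by omega)
      rwa [Nat.sub_sub_self (by omega)] at h3

/-- The power doubles, while `nu (m + 1) ≤ m` is smaller than the gain `2 ^ (m - 1)`. -/
theorem two_pow_sub_nu_lt (hm : 5 ≤ m) :
    2 ^ (m - 1) - nu m < 2 ^ m - nu (m + 1) := by
  have h1 := nu_le_pred (m := m + 1) (by omega)
  have h2 := two_mul_le_two_pow hm
  have h3 := two_pow_pred (m := m) (by omega)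
  have h4 := two_pow_pred (m := m + 1) (by omega)
  rw [Nat.add_sub_cancel, show m + 1 - 2 = m - 1 by omega] at h4
  have h5 := nu_le_pred hm
  omega

theorem two_pow_sub_nu_mono {k : ℕ} (hk : 5 ≤ k) (hkm : k ≤ m) :
    2 ^ (k - 1) - nu k ≤ 2 ^ (m - 1) - nu m := by
  induction m, hkm using Nat.le_induction with
  | base => exact le_rfl
  | succ m hkm ih =>
    have := two_pow_sub_nu_lt (m := m) (by omega)
    rw [Nat.add_sub_cancel]
    omega

theorem le_two_pow_sub_nu (hm : 5 ≤ m) : m ≤ 2 ^ (m - 1) - nu m := by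
  have h1 := nu_le_pred hm
  have h2 := two_mul_le_two_pow hm
  have h3 := two_pow_pred (m := m) (by omega)
  omega

theorem cost_hypercube_eq (h : HasAsymmetric m n) (hmin : ∀ k, HasAsymmetric k n → m ≤ k) :
    cost (hypercube n) = m := by
  rw [cost_hypercube]
  exact le_antisymm (Nat.sInf_le h) (hmin _ (Nat.sInf_mem (s := {k | HasAsymmetric k n}) ⟨m, h⟩))

theorem mem_Icc_iff (hm : 6 ≤ m) :
    (n : ℤ) ∈ Set.Icc ((2 : ℤ) ^ (m - 2) - (nu (m - 1) : ℤ) + 1)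
        ((2 : ℤ) ^ (m - 1) - (nu m : ℤ)) ↔
      2 ^ (m - 2) - nu (m - 1) < n ∧ n ≤ 2 ^ (m - 1) - nu m := by
  have h1 := le_two_pow_sub_nu (m := m) (by omega)
  have h2 := le_two_pow_sub_nu (m := m - 1) (by omega)
  rw [show m - 1 - 1 = m - 2 by omega] at h2
  rw [Set.mem_Icc]
  -- Both truncated subtractions are exact, so they agree with the integer ones.
  zify [show nu m ≤ 2 ^ (m - 1) by omega, show nu (m - 1) ≤ 2 ^ (m - 2) by omega]
  omega

/-- The intervals in which the cost is constant cover all dimensions from `13` on. -/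
theorem exists_interval (hn : 13 ≤ n) :
    ∃ m, 6 ≤ m ∧ 2 ^ (m - 2) - nu (m - 1) < n ∧ n ≤ 2 ^ (m - 1) - nu m := by
  classical
  have hex : ∃ m, 5 ≤ m ∧ n ≤ 2 ^ (m - 1) - nu m :=
    ⟨n, by omega, le_two_pow_sub_nu (by omega)⟩
  obtain ⟨h1, h2⟩ := Nat.find_spec hex
  -- For five rows the upper end is `16 - 4 = 12`.
  have h3 : Nat.find hex ≠ 5 := by
    intro h
    rw [h, nu_five] at h2
    omega
  refine ⟨Nat.find hex, by omega, ?_, h2⟩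
  have h4 := Nat.find_min hex (m := Nat.find hex - 1) (by omega)
  rw [show ∀ a, a - 1 - 1 = a - 2 by omega] at h4
  by_contra! hc
  exact h4 ⟨by omega, hc⟩

theorem le_of_interval {k : ℕ} (hk : 5 ≤ k) (h1 : 2 ^ (m - 2) - nu (m - 1) < n)
    (h2 : n ≤ 2 ^ (k - 1) - nu k) : m ≤ k := by
  by_contra! h
  have h3 := two_pow_sub_nu_mono (m := m - 1) hk (by omega)
  rw [show m - 1 - 1 = m - 2 by omega] at h3
  omega

/-- Only the lower bound `nu m ≤ n` needs an argument: `n` exceeds `2 ^ (m - 2) - (m - 2)`, which is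
at least `m`, while `nu m ≤ m - 1`. -/
theorem hasAsymmetric_of_interval (hm : 6 ≤ m) (h1 : 2 ^ (m - 2) - nu (m - 1) < n)
    (h2 : n ≤ 2 ^ (m - 1) - nu m) : HasAsymmetric m n := by
  have h3 := nu_le_pred (m := m) (by omega)
  have h4 := nu_le_pred (m := m - 1) (by omega)
  have h5 := two_mul_le_two_pow (m := m) (by omega)
  have h6 := two_pow_pred (m := m) (by omega)
  rw [hasAsymmetric_iff (by omega)]
  omega

theorem cost_eq_of_interval (hn : 4 ≤ n) (hm : 6 ≤ m) (h1 : 2 ^ (m - 2) - nu (m - 1) < n)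
    (h2 : n ≤ 2 ^ (m - 1) - nu m) : cost (hypercube n) = m := by
  refine cost_hypercube_eq (hasAsymmetric_of_interval hm h1 h2) fun k hk => ?_
  have h3 := five_le_of_hasAsymmetric hk hn
  have h4 := (hasAsymmetric_iff h3).1 hk
  exact le_of_interval h3 h1 (by omega)

theorem hasAsymmetric_five (h1 : 4 ≤ n) (h2 : n ≤ 12) : HasAsymmetric 5 n := by
  rw [hasAsymmetric_iff le_rfl, nu_five]
  omega

end Main

end HypercubeCost

theorem mainTheorem1 :
    (∀ n : ℕ, 4 ≤ n → HypercubeCost.IsDistinguishable (HypercubeCost.hypercube n) 2) ∧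
    (∀ m : ℕ, 5 ≤ m →
      ∃ (n : ℕ) (X : Matrix (Fin m) (Fin n) Bool), HypercubeCost.IsAsymmetric X) ∧
    (∀ n : ℕ, 4 ≤ n → n ≤ 12 → HypercubeCost.cost (HypercubeCost.hypercube n) = 5) ∧
    (∀ n : ℕ, 13 ≤ n →
      ∃ m : ℕ,
        (6 ≤ m ∧ (n : ℤ) ∈ Set.Icc ((2 : ℤ) ^ (m - 2) - (HypercubeCost.nu (m - 1) : ℤ) + 1)
          ((2 : ℤ) ^ (m - 1) - (HypercubeCost.nu m : ℤ))) ∧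
        (∀ k : ℕ,
          (6 ≤ k ∧ (n : ℤ) ∈ Set.Icc ((2 : ℤ) ^ (k - 2) - (HypercubeCost.nu (k - 1) : ℤ) + 1)
            ((2 : ℤ) ^ (k - 1) - (HypercubeCost.nu k : ℤ))) → k = m) ∧
        HypercubeCost.cost (HypercubeCost.hypercube n) = m) := by
  refine ⟨fun n hn => ?_, fun m hm => ⟨_, HypercubeCost.hasAsymmetric_pred hm⟩,
    fun n h1 h2 => HypercubeCost.cost_hypercube_eq (HypercubeCost.hasAsymmetric_five h1 h2)
      fun k hk => HypercubeCost.five_le_of_hasAsymmetric hk h1, fun n hn => ?_⟩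
  · rcases le_or_gt n 12 with h | h
    · exact (HypercubeCost.hasAsymmetric_five hn h).isDistinguishable
    · obtain ⟨m, hm, h1, h2⟩ := HypercubeCost.exists_interval h
      exact (HypercubeCost.hasAsymmetric_of_interval hm h1 h2).isDistinguishable
  · obtain ⟨m, hm, h1, h2⟩ := HypercubeCost.exists_interval hn
    refine ⟨m, ⟨hm, (HypercubeCost.mem_Icc_iff hm).2 ⟨h1, h2⟩⟩, ?_,
      HypercubeCost.cost_eq_of_interval (by omega) hm h1 h2⟩
    rintro k ⟨hk, hnk⟩
    obtain ⟨h3, h4⟩ := (HypercubeCost.mem_Icc_iff hk).1 hnk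
    exact le_antisymm (HypercubeCost.le_of_interval (by omega) h3 h2)
      (HypercubeCost.le_of_interval (by omega) h1 h4)
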